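/- For complex $a,q$ and an integer $n\ge 0$ write $(a;q)_n=\prod_{k=0}^{n-1}(1-aq^k)$ and, for $|q|<1$, $(a;q)_\infty=\prod_{k\ge 0}(1-aq^k)$ and $(a,b,c;q)_\infty=(a;q)_\infty(b;q)_\infty(c;q)_\infty$. For integers $n,k$ let $$\begin{bmatrix} n\\ k\end{bmatrix}_{q}=\frac{(q;q)_n}{(q;q)_k(q;q)_{n-k}}\ \text{ if } 0\le k\le n,\qquad \begin{bmatrix} n\\ k\end{bmatrix}_{q}=0\ \text{ otherwise.}$$ Let $m\ge 0$ be an integer and let $q$ be a complex number with $|q|<1$, and with $q\neq 0$ if $m\ge 2$. Then the series on the left below converges and $$\sum_{n=0}^{\infty}\frac{q^{2n^2+2mn}}{(q;q^2)_{m+n}(q^2;q^2)_n}=\frac{(-1)^{m-1}}{q^{m(m-1)}(q^2;q^2)_\infty}\Big[a_m(q)\,(-q,-q^7,q^8;q^8)_\infty-b_m(q)\,(-q^3,-q^5,q^8;q^8)_\infty\Big],$$ where $a_0(q)=0$, $b_0(q)=1$, and for $m\ge 1$ $$a_m(q)=\sum_{n,l\ge 0}q^{n^2+l^2}(-1)^{n-l}\begin{bmatrix}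 m-1-l\\ n-l\end{bmatrix}_{q^2}\begin{bmatrix} m-1-n\\ l\end{bmatrix}_{q^2},$$ $$b_m(q)=\sum_{n,l\ge 0}q^{n^2+2n+l^2}(-1)^{n-l}\begin{bmatrix} m-2-l\\ n-l\end{bmatrix}_{q^2}\begin{bmatrix} m-2-n\\ l\end{bmatrix}_{q^2}$$ (only finitely many terms of these sums are nonzero). -/

import Mathlib

noncomputable section

namespace QSeries

/-- The finite `q`-shifted factorial `(a; q)_n = ∏_{k=0}^{n-1} (1 - a q^k)`. -/
def poch (a q : ℂ) (n : ℕ) : ℂ := ∏ k ∈ Finset.range n, (1 - a * q ^ k)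

/-- The infinite `q`-shifted factorial `(a; q)_∞ = ∏_{k ≥ 0} (1 - a q^k)`. -/
def pochInf (a q : ℂ) : ℂ := ∏' k : ℕ, (1 - a * q ^ k)

/-- For `|q| < 1` the product defining `(a; q)_∞` converges. -/
theorem multipliable_pochInf (a : ℂ) {q : ℂ} (hq : ‖q‖ < 1) :
    Multipliable fun k : ℕ => 1 - a * q ^ k := by
  have h : Summable fun k : ℕ => ‖-(a * q ^ k)‖ := by
    simpa only [norm_neg, norm_mul, norm_pow] using
      (summable_geometric_of_lt_one (norm_nonneg q) hq).mul_left ‖a‖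
  simpa only [sub_eq_add_neg] using multipliable_one_add_of_summable h

/-- The compact notation `(a, b, c; q)_∞ = (a; q)_∞ (b; q)_∞ (c; q)_∞`. -/
def pochInf₃ (a b c q : ℂ) : ℂ := pochInf a q * pochInf b q * pochInf c q

/-- The Gaussian polynomial with top entry `n`, bottom entry `k` and base `q`, for integers
`n` and `k`: it is `(q;q)_n / ((q;q)_k (q;q)_{n-k})` if `0 ≤ k ≤ n`, and `0` otherwise. -/
def gauss (q : ℂ) (n k : ℤ) : ℂ :=
  if 0 ≤ k ∧ k ≤ n then
    poch q q n.toNat / (poch q q k.toNat * poch q q (n - k).toNat)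
  else 0

/-- The `(n, l)` term of `a_m(q)`. -/
def aTerm (m : ℕ) (q : ℂ) (n l : ℕ) : ℂ :=
  q ^ (n ^ 2 + l ^ 2) * (-1) ^ ((n : ℤ) - l) *
    gauss (q ^ 2) ((m : ℤ) - 1 - l) ((n : ℤ) - l) * gauss (q ^ 2) ((m : ℤ) - 1 - n) l

/-- The `(n, l)` term of `b_m(q)`. -/
def bTerm (m : ℕ) (q : ℂ) (n l : ℕ) : ℂ :=
  q ^ (n ^ 2 + 2 * n + l ^ 2) * (-1) ^ ((n : ℤ) - l) *
    gauss (q ^ 2) ((m : ℤ) - 2 - l) ((n : ℤ) - l) * gauss (q ^ 2) ((m : ℤ) - 2 - n) l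

/-- Only the terms with `n, l < m` contribute to `a_m(q)`. -/
theorem aTerm_eq_zero (m : ℕ) (q : ℂ) (n l : ℕ) (h : m ≤ n ∨ m ≤ l) : aTerm m q n l = 0 := by
  by_cases h1 : m ≤ n
  · have : gauss (q ^ 2) ((m : ℤ) - 1 - n) l = 0 := if_neg (by omega)
    simp [aTerm, this]
  · have : gauss (q ^ 2) ((m : ℤ) - 1 - l) ((n : ℤ) - l) = 0 := if_neg (by omega)
    simp [aTerm, this]

/-- Only the terms with `n, l < m` contribute to `b_m(q)`. -/
theorem bTerm_eq_zero (m : ℕ) (q : ℂ) (n l : ℕ) (h : m ≤ n ∨ m ≤ l) : bTerm m q n l = 0 := by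
  by_cases h1 : m ≤ n
  · have : gauss (q ^ 2) ((m : ℤ) - 2 - n) l = 0 := if_neg (by omega)
    simp [bTerm, this]
  · have : gauss (q ^ 2) ((m : ℤ) - 2 - l) ((n : ℤ) - l) = 0 := if_neg (by omega)
    simp [bTerm, this]

/-- `a_m(q)`: it is `0` for `m = 0`, and for `m ≥ 1` the sum of the terms over all `n, l ≥ 0`,
written as a finite sum because the terms outside the range vanish (`aTerm_eq_zero`). -/
def a (m : ℕ) (q : ℂ) : ℂ :=
  if m = 0 then 0 else ∑ n ∈ Finset.range m, ∑ l ∈ Finset.range m, aTerm m q n l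

/-- `b_m(q)`: it is `1` for `m = 0`, and for `m ≥ 1` the sum of the terms over all `n, l ≥ 0`,
written as a finite sum because the terms outside the range vanish (`bTerm_eq_zero`). -/
def b (m : ℕ) (q : ℂ) : ℂ :=
  if m = 0 then 1 else ∑ n ∈ Finset.range m, ∑ l ∈ Finset.range m, bTerm m q n l

end QSeries

end

namespace QSeries
open Filter Topology

/-! Write F_m for the series. Comparing terms gives q^(2m+2) F_{m+2} = F_m - (1 - q^(2m+1)) F_{m+1}
(`tsum_lhsTerm_recurrence`), so (-1)^(m+1) q^(m(m-1)) F_m satisfies X_{m+2} = (1 - q^(2m+1)) X_{m+1}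
+ q^(2m) X_m. Both a_m and b_m satisfy the same recurrence (`a_recurrence`, `b_recurrence`), with
initial values 0, 1 and 1, 0. Hence only F_0 and F_1 have to be evaluated.

For these let s^2 = q. Then F_0 + s F_1 is the even-odd splitting of ∑ s^(n^2)/(q;q)_n, which is
(-s;q)_∞ by Euler. Multiplied by (q^2;q^2)_∞ this is a Jacobi triple product, equal to ∑ s^(2j^2-j)
over the integers j, and splitting by the parity of j gives the two products of base q^8. Replacing
s by -s separates F_0 from F_1. Jacobi's and Euler's identities are both limits of
`hasSum_finite_triple_product`. -/

/-! ### Shifted factorials: nonvanishing, limits, uniform bounds -/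

theorem poch_zero (a q : ℂ) : poch a q 0 = 1 := by simp [poch]

theorem poch_succ (a q : ℂ) (n : ℕ) : poch a q (n + 1) = poch a q n * (1 - a * q ^ n) := by
  simp [poch, Finset.prod_range_succ]

theorem one_sub_mul_pow_ne_zero {a q : ℂ} (ha : ‖a‖ < 1) (hq : ‖q‖ < 1) (n : ℕ) :
    1 - a * q ^ n ≠ 0 := by
  intro h
  have h1 : ‖a * q ^ n‖ < 1 := by
    rw [norm_mul, norm_pow]
    exact mul_lt_one_of_nonneg_of_lt_one_left (norm_nonneg _) ha
      (pow_le_one₀ (norm_nonneg _) hq.le)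
  rw [← sub_eq_zero.mp h, norm_one] at h1
  exact lt_irrefl _ h1

theorem poch_ne_zero {a q : ℂ} (ha : ‖a‖ < 1) (hq : ‖q‖ < 1) (n : ℕ) : poch a q n ≠ 0 :=
  Finset.prod_ne_zero_iff.mpr fun k _ => one_sub_mul_pow_ne_zero ha hq k

theorem tendsto_poch (a : ℂ) {q : ℂ} (hq : ‖q‖ < 1) :
    Tendsto (poch a q) atTop (𝓝 (pochInf a q)) :=
  (multipliable_pochInf a hq).tendsto_prod_tprod_nat

theorem pochInf_ne_zero {a q : ℂ} (ha : ‖a‖ < 1) (hq : ‖q‖ < 1) : pochInf a q ≠ 0 := by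
  have := tprod_one_add_ne_zero_of_summable (f := fun k : ℕ => -(a * q ^ k))
    (fun k => by simpa [sub_eq_add_neg] using one_sub_mul_pow_ne_zero ha hq k)
    (by simpa only [norm_neg, norm_mul, norm_pow] using
      (summable_geometric_of_lt_one (norm_nonneg q) hq).mul_left ‖a‖)
  simpa only [pochInf, sub_eq_add_neg] using this

theorem exists_norm_poch_le (a : ℂ) {q : ℂ} (hq : ‖q‖ < 1) :
    ∃ C, 0 < C ∧ ∀ n, ‖poch a q n‖ ≤ C :=
  (Metric.isBounded_range_of_tendsto _ (tendsto_poch a hq)).exists_pos_norm_le.imp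
    fun _ h => ⟨h.1, fun n => h.2 _ ⟨n, rfl⟩⟩

theorem exists_norm_inv_poch_le {a q : ℂ} (ha : ‖a‖ < 1) (hq : ‖q‖ < 1) :
    ∃ C, 0 < C ∧ ∀ n, ‖(poch a q n)⁻¹‖ ≤ C :=
  (Metric.isBounded_range_of_tendsto _
    ((tendsto_poch a hq).inv₀ (pochInf_ne_zero ha hq))).exists_pos_norm_le.imp
    fun _ h => ⟨h.1, fun n => h.2 _ ⟨n, rfl⟩⟩

/-! ### Gaussian polynomials -/

theorem gauss_of_neg (q : ℂ) (n : ℤ) {k : ℤ} (h : k < 0) : gauss q n k = 0 :=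
  if_neg (by omega)

theorem gauss_of_lt (q : ℂ) {n k : ℤ} (h : n < k) : gauss q n k = 0 :=
  if_neg (by omega)

theorem gauss_add (q : ℂ) (k j : ℕ) :
    gauss q ((k : ℤ) + j) k = poch q q (k + j) / (poch q q k * poch q q j) := by
  rw [gauss, if_pos (by omega)]
  congr 2
  simp

theorem gauss_symm (q : ℂ) (n k : ℤ) : gauss q n (n - k) = gauss q n k := by
  unfold gauss
  by_cases h : 0 ≤ k ∧ k ≤ n
  · rw [if_pos h, if_pos (by omega), sub_sub_cancel, mul_comm (poch q q (n - k).toNat)]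
  · rw [if_neg h, if_neg (by omega)]

theorem gauss_zero_right {q : ℂ} (hq : ‖q‖ < 1) {n : ℤ} (hn : 0 ≤ n) : gauss q n 0 = 1 := by
  lift n to ℕ using hn
  have := gauss_add q 0 n
  simp only [Nat.cast_zero, zero_add, poch_zero, one_mul] at this
  rw [this, div_self (poch_ne_zero hq hq n)]

/-- The `q`-Pascal rule. -/
theorem gauss_succ {q : ℂ} (hq : ‖q‖ < 1) {n : ℤ} (hn : 0 ≤ n) (k : ℤ) :
    gauss q (n + 1) k = gauss q n k + q ^ (n + 1 - k).toNat * gauss q n (k - 1) := by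
  rcases lt_trichotomy k 0 with hk | rfl | hk
  · simp [gauss_of_neg q _ hk, gauss_of_neg q _ (show k - 1 < 0 by omega)]
  · rw [gauss_zero_right hq hn, gauss_zero_right hq (by omega),
      gauss_of_neg q _ (show (0 : ℤ) - 1 < 0 by omega)]
    simp
  rcases lt_trichotomy k (n + 1) with hk' | rfl | hk'
  · obtain ⟨i, rfl⟩ : ∃ i : ℕ, k = i + 1 := ⟨(k - 1).toNat, by omega⟩
    obtain ⟨j, rfl⟩ : ∃ j : ℕ, n = i + 1 + j := ⟨(n - (i + 1)).toNat, by omega⟩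
    have h1 := gauss_add q (i + 1) (j + 1)
    have h2 := gauss_add q (i + 1) j
    have h3 := gauss_add q i (j + 1)
    push_cast at h1 h2 h3
    have e1 : (i : ℤ) + 1 + j + 1 = i + 1 + (j + 1) := by ring
    have e2 : (i : ℤ) + 1 + j = i + (j + 1) := by ring
    have e3 : ((i : ℤ) + 1 + j + 1 - (i + 1)).toNat = j + 1 := by omega
    rw [e3, e1, h1, h2, add_sub_cancel_right, e2, h3]
    have e4 : i + 1 + (j + 1) = (i + j + 1) + 1 := by ring
    have e5 : i + 1 + j = i + j + 1 := by ring
    have e6 : i + (j + 1) = i + j + 1 := by ring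
    rw [e4, e5, e6, poch_succ q q (i + j + 1), poch_succ q q i, poch_succ q q j]
    have hi := poch_ne_zero hq hq i
    have hj := poch_ne_zero hq hq j
    have hi' := one_sub_mul_pow_ne_zero hq hq i
    have hj' := one_sub_mul_pow_ne_zero hq hq j
    field_simp
    ring
  · lift n to ℕ using hn
    have h1 := gauss_add q n 0
    have h2 := gauss_add q (n + 1) 0
    push_cast at h1 h2
    simp only [add_zero, poch_zero, mul_one, div_self (poch_ne_zero hq hq _)] at h1 h2
    simp [h1, h2, gauss_of_lt q (show (n : ℤ) < n + 1 by omega)]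
  · rw [gauss_of_lt q hk', gauss_of_lt q (show n < k by omega),
      gauss_of_lt q (show n < k - 1 by omega)]
    simp

/-- The other `q`-Pascal rule. -/
theorem gauss_succ' {q : ℂ} (hq : ‖q‖ < 1) {n : ℤ} (hn : 0 ≤ n) (k : ℤ) :
    gauss q (n + 1) k = q ^ k.toNat * gauss q n k + gauss q n (k - 1) := by
  rw [← gauss_symm, gauss_succ hq hn, ← gauss_symm q n k, ← gauss_symm q n (k - 1)]
  have e1 : n + 1 - (n + 1 - k) = k := by ring
  have e2 : n + 1 - k - 1 = n - k := by ring
  have e3 : n - (k - 1) = n + 1 - k := by ring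
  rw [e1, e2, e3, add_comm]

/-- Supplies the dominating constant when limits are taken inside sums; it works because (q;q)_n and
its inverse are both bounded in n. -/
theorem exists_norm_gauss_le {q : ℂ} (hq : ‖q‖ < 1) :
    ∃ C, 0 < C ∧ ∀ n k, ‖gauss q n k‖ ≤ C := by
  obtain ⟨A, hA, hA'⟩ := exists_norm_poch_le q hq
  obtain ⟨B, hB, hB'⟩ := exists_norm_inv_poch_le hq hq
  refine ⟨A * (B * B), by positivity, fun n k => ?_⟩
  unfold gauss
  split_ifs
  · rw [div_eq_mul_inv, mul_inv, norm_mul, norm_mul]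
    gcongr
    exacts [hA' _, hB' _, hB' _]
  · rw [norm_zero]; positivity

/-! ### Triangular exponents and the finite triple product -/

/-- The triangular number `j (j + 1) / 2` of an integer `j`. -/
def tri (j : ℤ) : ℕ := (j * (j + 1) / 2).toNat

theorem two_mul_tri (j : ℤ) : 2 * (tri j : ℤ) = j * (j + 1) := by
  have h : 0 ≤ j * (j + 1) := by
    rcases le_or_gt 0 j with h | h
    · positivity
    · nlinarith
  have h2 := Int.mul_ediv_cancel' (Int.even_mul_succ_self j).two_dvd
  rw [tri, Int.toNat_of_nonneg (by positivity), h2]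

theorem tri_eq_tri_pred_add (j : ℤ) : (tri j : ℤ) = tri (j - 1) + j := by
  have h1 := two_mul_tri j
  have h2 := two_mul_tri (j - 1)
  linarith [h1, h2, show j * (j + 1) = (j - 1) * (j - 1 + 1) + 2 * j by ring]

/-- The finite Jacobi triple product. -/
theorem hasSum_finite_triple_product {x y : ℂ} (h : ‖x * y‖ < 1) (m n : ℕ) :
    HasSum (fun j : ℤ => gauss (x * y) ((m : ℤ) + n) (n + j) * (x ^ tri j * y ^ tri (j - 1)))
      (poch (-x) (x * y) m * poch (-y) (x * y) n) := by
  induction m with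
  | zero =>
    induction n with
    | zero =>
      simp only [poch_zero, mul_one]
      have hf : ∀ j : ℤ, j ≠ 0 → gauss (x * y) (((0 : ℕ) : ℤ) + (0 : ℕ)) ((0 : ℕ) + j) *
          (x ^ tri j * y ^ tri (j - 1)) = 0 := fun j hj => by
        rcases lt_or_gt_of_ne hj with hj | hj
        · rw [gauss_of_neg _ _ (by simpa using hj), zero_mul]
        · rw [gauss_of_lt _ (by simpa using hj), zero_mul]
      have h0 := gauss_zero_right h le_rfl
      simpa [h0, tri] using hasSum_single 0 hf
    | succ n ih =>
      rw [poch_succ, ← mul_assoc, mul_sub, mul_one, sub_eq_add_neg]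
      -- The new factor is 1 + y(xy)^n. Its second summand, with j shifted to j + 1, matches the
      -- second term of the q-Pascal rule.
      have ih' := (((Equiv.addRight (1 : ℤ)).hasSum_iff.mpr ih).mul_left (y * (x * y) ^ n))
      convert! ih.add ih' using 1
      · ext j
        simp only [Function.comp_apply, Equiv.coe_addRight, add_sub_cancel_right]
        have e : ((0 : ℕ) : ℤ) + ((n + 1 : ℕ) : ℤ) = ((0 : ℕ) : ℤ) + n + 1 := by push_cast; ring
        rw [e, gauss_succ' h (by positivity), add_comm, add_mul]
        have e1 : ((n + 1 : ℕ) : ℤ) + j - 1 = n + j := by push_cast; ring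
        have e2 : ((n + 1 : ℕ) : ℤ) + j = n + (j + 1) := by push_cast; ring
        rw [e1, e2]
        congr 1
        -- The exponent identities fail where `toNat` truncates, but there the Gaussian polynomial
        -- vanishes.
        rcases lt_or_ge ((n : ℤ) + (j + 1)) 0 with hj | hj
        · simp [gauss_of_neg _ _ hj]
        · have ht := tri_eq_tri_pred_add j
          have ht' := tri_eq_tri_pred_add (j + 1)
          rw [add_sub_cancel_right] at ht'
          have f1 : tri (j + 1) + n = tri j + ((n : ℤ) + (j + 1)).toNat := by omega
          have f2 : tri j + 1 + n = tri (j - 1) + ((n : ℤ) + (j + 1)).toNat := by omega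
          have g1 : x ^ tri (j + 1) * x ^ n = x ^ tri j * x ^ ((n : ℤ) + (j + 1)).toNat := by
            rw [← pow_add, f1, pow_add]
          have g2 : y ^ tri j * y * y ^ n = y ^ tri (j - 1) * y ^ ((n : ℤ) + (j + 1)).toNat := by
            rw [← pow_succ, ← pow_add, f2, pow_add]
          rw [mul_pow, mul_pow]
          linear_combination (-gauss (x * y) ((0 : ℕ) + n) (n + (j + 1))) *
            (y ^ tri j * y * y ^ n * g1 + x ^ tri j * x ^ ((n : ℤ) + (j + 1)).toNat * g2)
      · ring
  | succ m ih =>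
    -- Now the new factor is 1 + x(xy)^m, the shift is to j - 1, and the other q-Pascal rule
    -- applies.
    have ih' := (((Equiv.subRight (1 : ℤ)).hasSum_iff.mpr ih).mul_left (x * (x * y) ^ m))
    convert! ih.add ih' using 1
    · ext j
      simp only [Function.comp_apply, Equiv.subRight_apply]
      have e : ((m + 1 : ℕ) : ℤ) + (n : ℤ) = m + n + 1 := by push_cast; ring
      rw [e, gauss_succ h (by positivity), add_mul]
      congr 1
      have e1 : (n : ℤ) + j - 1 = n + (j - 1) := by ring
      rw [e1]
      rcases lt_or_ge ((m : ℤ) + n) (n + (j - 1)) with hj | hj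
      · simp [gauss_of_lt _ hj]
      · have ht := tri_eq_tri_pred_add j
        have ht' := tri_eq_tri_pred_add (j - 1)
        have f1 : tri (j - 1) + 1 + m = tri j + ((m : ℤ) + n + 1 - (n + j)).toNat := by omega
        have f2 : tri (j - 1 - 1) + m = tri (j - 1) + ((m : ℤ) + n + 1 - (n + j)).toNat := by
          omega
        have g1 : x ^ tri (j - 1) * x * x ^ m =
            x ^ tri j * x ^ ((m : ℤ) + n + 1 - (n + j)).toNat := by
          rw [← pow_succ, ← pow_add, f1, pow_add]
        have g2 : y ^ tri (j - 1 - 1) * y ^ m =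
            y ^ tri (j - 1) * y ^ ((m : ℤ) + n + 1 - (n + j)).toNat := by
          rw [← pow_add, f2, pow_add]
        rw [mul_pow, mul_pow]
        linear_combination (-gauss (x * y) (m + n) (n + (j - 1))) *
          (y ^ tri (j - 1 - 1) * y ^ m * g1 +
            x ^ tri j * x ^ ((m : ℤ) + n + 1 - (n + j)).toNat * g2)
    · rw [poch_succ]; ring


/-! ### Limits: Jacobi's triple product and Euler's expansion -/

theorem summable_pow_tri {r : ℝ} (h0 : 0 ≤ r) (h1 : r < 1) :
    Summable fun j : ℤ => r ^ tri j := by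
  have hg := summable_geometric_of_lt_one h0 h1
  apply Summable.of_nat_of_neg
  · refine hg.of_nonneg_of_le (fun n => by positivity) fun n => ?_
    refine pow_le_pow_of_le_one h0 h1.le ?_
    have := two_mul_tri n
    nlinarith
  -- The shift is needed since `tri (-1) = 0`: the usable bound is `tri (-(n + 1)) ≥ n`.
  · rw [← summable_nat_add_iff 1]
    refine hg.of_nonneg_of_le (fun n => by positivity) fun n => ?_
    refine pow_le_pow_of_le_one h0 h1.le ?_
    have := two_mul_tri (-((n + 1 : ℕ) : ℤ))
    push_cast at this
    nlinarith

theorem norm_pow_tri_mul_le {x y : ℂ} (hy : ‖y‖ ≤ 1) (j : ℤ) :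
    ‖x ^ tri j * y ^ tri (j - 1)‖ ≤ ‖x‖ ^ tri j := by
  rw [norm_mul, norm_pow, norm_pow]
  exact mul_le_of_le_one_right (by positivity) (pow_le_one₀ (norm_nonneg _) hy)

theorem tendsto_gauss_central {q : ℂ} (hq : ‖q‖ < 1) (j : ℤ) :
    Tendsto (fun n : ℕ => gauss q ((n : ℤ) + n) (n + j)) atTop (𝓝 (pochInf q q)⁻¹) := by
  have hP := pochInf_ne_zero hq hq
  have ht := tendsto_poch q hq
  have h1 : Tendsto (fun n : ℕ => n + n) atTop atTop :=
    tendsto_atTop_mono (fun n => Nat.le_add_left n n) tendsto_id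
  have h2 : ∀ i : ℤ, Tendsto (fun n : ℕ => ((n : ℤ) + i).toNat) atTop atTop := fun i =>
    tendsto_atTop.mpr fun b => by
      filter_upwards [eventually_ge_atTop (b + i.natAbs)] with n hn
      omega
  have h3 := (ht.comp h1).div ((ht.comp (h2 j)).mul (ht.comp (h2 (-j)))) (mul_ne_zero hP hP)
  rw [div_mul_cancel_left₀ hP] at h3
  refine h3.congr' ?_
  filter_upwards [eventually_ge_atTop j.natAbs] with n hn
  simp only [Function.comp_apply, Pi.div_apply]
  rw [gauss, if_pos (by omega)]
  have e1 : ((n : ℤ) + n).toNat = n + n := by omega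
  have e2 : (n : ℤ) + n - (n + j) = n + -j := by ring
  rw [e1, e2]

theorem tendsto_gauss_top {q : ℂ} (hq : ‖q‖ < 1) (k : ℕ) :
    Tendsto (fun n : ℕ => gauss q n k) atTop (𝓝 (poch q q k)⁻¹) := by
  have hP := pochInf_ne_zero hq hq
  have ht := tendsto_poch q hq
  have h3 := ht.div ((tendsto_const_nhds (x := poch q q k)).mul
    (ht.comp (tendsto_sub_atTop_nat k))) (mul_ne_zero (poch_ne_zero hq hq k) hP)
  rw [div_mul_cancel_right₀ hP] at h3
  refine h3.congr' ?_
  filter_upwards [eventually_ge_atTop k] with n hn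
  simp only [Function.comp_apply, Pi.div_apply]
  rw [gauss, if_pos (by omega)]
  have e1 : ((n : ℤ) - k).toNat = n - k := by omega
  simp [e1]

/-- The Jacobi triple product. -/
theorem hasSum_triple_product {x y : ℂ} (hx : ‖x‖ < 1) (hy : ‖y‖ < 1) :
    HasSum (fun j : ℤ => x ^ tri j * y ^ tri (j - 1))
      (pochInf₃ (-x) (-y) (x * y) (x * y)) := by
  have hp : ‖x * y‖ < 1 := by
    rw [norm_mul]; exact mul_lt_one_of_nonneg_of_lt_one_left (norm_nonneg _) hx hy.le
  have hP := pochInf_ne_zero hp hp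
  obtain ⟨C, hC, hC'⟩ := exists_norm_gauss_le hp
  have hs := summable_pow_tri (norm_nonneg x) hx
  have hsum : Summable fun j : ℤ => x ^ tri j * y ^ tri (j - 1) :=
    .of_norm_bounded hs (norm_pow_tri_mul_le hy.le)
  have h1 := tendsto_tsum_of_dominated_convergence (𝓕 := atTop)
    (f := fun (n : ℕ) (j : ℤ) =>
      gauss (x * y) ((n : ℤ) + n) (n + j) * (x ^ tri j * y ^ tri (j - 1)))
    (hs.mul_left C) (fun j => (tendsto_gauss_central hp j).mul_const _)
    (.of_forall fun n j => by
      rw [norm_mul]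
      exact mul_le_mul (hC' _ _) (norm_pow_tri_mul_le hy.le j) (norm_nonneg _) hC.le)
  simp_rw [(hasSum_finite_triple_product hp _ _).tsum_eq, tsum_mul_left] at h1
  have h2 := tendsto_nhds_unique h1 ((tendsto_poch (-x) hp).mul (tendsto_poch (-y) hp))
  rw [hsum.hasSum_iff, pochInf₃, ← h2]
  field_simp

/-- Euler's expansion of an infinite product, in the symmetric case `(-s; s²)_∞`. -/
theorem hasSum_euler {s : ℂ} (hs : ‖s‖ < 1) :
    HasSum (fun n : ℕ => s ^ n ^ 2 / poch (s * s) (s * s) n) (pochInf (-s) (s * s)) := by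
  have hp : ‖s * s‖ < 1 := by
    rw [norm_mul]; exact mul_lt_one_of_nonneg_of_lt_one_left (norm_nonneg _) hs hs.le
  obtain ⟨C, hC, hC'⟩ := exists_norm_gauss_le hp
  obtain ⟨B, hB, hB'⟩ := exists_norm_inv_poch_le hp hp
  have hfin : ∀ N : ℕ, HasSum (fun n : ℕ => gauss (s * s) N n * s ^ n ^ 2)
      (poch (-s) (s * s) N) := fun N => by
    -- With x = y = s and no factors in y, the finite triple product is the q-binomial theorem,
    -- since tri n + tri (n - 1) = n^2.
    have h := hasSum_finite_triple_product hp N 0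
    rw [poch_zero, mul_one] at h
    rw [← (Nat.cast_injective (R := ℤ)).hasSum_iff] at h
    · convert! h using 1
      ext n
      have h1 := tri_eq_tri_pred_add n
      have h2 := two_mul_tri n
      have e : n ^ 2 = tri n + tri (n - 1) := by zify; linarith
      simp only [Function.comp_apply, Nat.cast_zero, add_zero, zero_add]
      rw [e, pow_add]
    · intro j hj
      have hj' : j < 0 := by
        by_contra hj'
        exact hj ⟨j.toNat, by omega⟩
      simp [gauss_of_neg _ _ hj']
  have hsq : Summable fun n : ℕ => ‖s‖ ^ n ^ 2 :=
    (summable_geometric_of_lt_one (norm_nonneg s) hs).of_nonneg_of_le (fun n => by positivity)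
      fun n => pow_le_pow_of_le_one (norm_nonneg s) hs.le (Nat.le_self_pow two_ne_zero n)
  have h1 := tendsto_tsum_of_dominated_convergence (𝓕 := atTop)
    (f := fun (N : ℕ) (n : ℕ) => gauss (s * s) N n * s ^ n ^ 2)
    (hsq.mul_left C) (fun j => (tendsto_gauss_top hp j).mul_const _)
    (.of_forall fun N n => by
      rw [norm_mul, norm_pow]
      exact mul_le_mul_of_nonneg_right (hC' _ _) (by positivity))
  simp_rw [(hfin _).tsum_eq] at h1
  have h2 := tendsto_nhds_unique h1 (tendsto_poch (-s) hp)
  have hsum : Summable fun n : ℕ => (poch (s * s) (s * s) n)⁻¹ * s ^ n ^ 2 := by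
    refine .of_norm_bounded (hsq.mul_left B) fun n => ?_
    rw [norm_mul, norm_pow]
    exact mul_le_mul_of_nonneg_right (hB' _) (by positivity)
  simp_rw [div_eq_inv_mul]
  rw [hsum.hasSum_iff, h2]

/-! ### Even-odd dissections -/

/-- Splitting a `q`-shifted factorial into its even and odd factors. -/
theorem pochInf_eq_mul (a : ℂ) {q : ℂ} (hq : ‖q‖ < 1) :
    pochInf a q = pochInf a (q ^ 2) * pochInf (a * q) (q ^ 2) := by
  have hq2 : ‖q ^ 2‖ < 1 := by
    rw [norm_pow]; exact pow_lt_one₀ (norm_nonneg _) hq two_ne_zero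
  have h1 : (fun k : ℕ => 1 - a * (q ^ 2) ^ k) = fun k => 1 - a * q ^ (2 * k) := by
    ext k; rw [pow_mul]
  have h2 : (fun k : ℕ => 1 - a * q * (q ^ 2) ^ k) = fun k => 1 - a * q ^ (2 * k + 1) := by
    ext k; rw [← pow_mul]; ring
  have m1 := multipliable_pochInf a hq2
  have m2 := multipliable_pochInf (a * q) hq2
  unfold pochInf
  rw [h1] at m1 ⊢
  rw [h2] at m2 ⊢
  exact (tprod_even_mul_odd (f := fun k => 1 - a * q ^ k) m1 m2).symm

theorem hasSum_int_even_add_odd {f : ℤ → ℂ} {a b : ℂ} (he : HasSum (fun k => f (2 * k)) a)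
    (ho : HasSum (fun k => f (2 * k + 1)) b) : HasSum f (a + b) := by
  have h1 := mul_right_injective₀ (two_ne_zero' ℤ)
  have h2 := (add_left_injective (1 : ℤ)).comp h1
  refine (h1.hasSum_range_iff.2 he).add_isCompl ?_ (h2.hasSum_range_iff.2 ho)
  simpa [Function.comp_def] using Int.isCompl_even_odd

/-- The even-odd dissection of `∑ s ^ (2 j² - j)` over the integers. -/
theorem triple_product_dissection {s q : ℂ} (hs : ‖s‖ < 1) (hsq : s ^ 2 = q) :
    pochInf₃ (-s) (-s ^ 3) (s ^ 4) (s ^ 4) =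
      pochInf₃ (-q ^ 3) (-q ^ 5) (q ^ 8) (q ^ 8) +
        s * pochInf₃ (-q) (-q ^ 7) (q ^ 8) (q ^ 8) := by
  have hn : ∀ k : ℕ, k ≠ 0 → ‖s ^ k‖ < 1 := fun k hk => by
    rw [norm_pow]; exact pow_lt_one₀ (norm_nonneg _) hs hk
  subst hsq
  -- The exponent of s here is 2j^2 - j. It is 2(4k^2 - k) at j = 2k and 1 + 2(4k^2 + 3k) at j = 2k
  -- + 1, which dictates the pairs (q^3, q^5) and (q^7, q) below.
  have h0 := hasSum_triple_product (x := s) (y := s ^ 3) hs (hn 3 (by simp))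
  have h1 := hasSum_triple_product (x := (s ^ 2) ^ 3) (y := (s ^ 2) ^ 5)
    (by rw [← pow_mul]; exact hn _ (by simp)) (by rw [← pow_mul]; exact hn _ (by simp))
  have h2 := hasSum_triple_product (x := (s ^ 2) ^ 7) (y := s ^ 2)
    (by rw [← pow_mul]; exact hn _ (by simp)) (hn _ (by simp))
  have a0 : s * s ^ 3 = s ^ 4 := by ring
  have a1 : (s ^ 2) ^ 3 * (s ^ 2) ^ 5 = (s ^ 2) ^ 8 := by ring
  have a2 : (s ^ 2) ^ 7 * s ^ 2 = (s ^ 2) ^ 8 := by ring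
  rw [a0] at h0
  rw [a1] at h1
  rw [a2] at h2
  have h3 : pochInf₃ (-(s ^ 2) ^ 7) (-s ^ 2) ((s ^ 2) ^ 8) ((s ^ 2) ^ 8) =
      pochInf₃ (-s ^ 2) (-(s ^ 2) ^ 7) ((s ^ 2) ^ 8) ((s ^ 2) ^ 8) := by
    unfold pochInf₃; ring
  rw [h3] at h2
  refine h0.unique (hasSum_int_even_add_odd ?_ ?_)
  · convert! h1 using 1
    ext k
    simp only [← pow_mul, ← pow_add]
    congr 1
    have e1 := two_mul_tri k
    have e2 := two_mul_tri (k - 1)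
    have e3 := two_mul_tri (2 * k)
    have e4 := two_mul_tri (2 * k - 1)
    zify
    linarith
  · convert! h2.mul_left s using 1
    ext k
    simp only [← pow_mul, ← pow_add, ← pow_succ']
    congr 1
    have e1 := two_mul_tri k
    have e2 := two_mul_tri (k - 1)
    have e3 := two_mul_tri (2 * k + 1)
    have e4 := two_mul_tri (2 * k + 1 - 1)
    zify
    linarith


/-! ### The series and its recurrence in m -/

/-- The `n`-th term of the series on the left-hand side. -/
noncomputable def lhsTerm (q : ℂ) (m n : ℕ) : ℂ :=
  q ^ (2 * n ^ 2 + 2 * m * n) / (poch q (q ^ 2) (m + n) * poch (q ^ 2) (q ^ 2) n)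

theorem norm_sq_lt_one {q : ℂ} (hq : ‖q‖ < 1) : ‖q ^ 2‖ < 1 := by
  rw [norm_pow]; exact pow_lt_one₀ (norm_nonneg _) hq two_ne_zero

theorem summable_lhsTerm {q : ℂ} (hq : ‖q‖ < 1) (m : ℕ) : Summable (lhsTerm q m) := by
  have hq2 := norm_sq_lt_one hq
  obtain ⟨A, hA, hA'⟩ := exists_norm_inv_poch_le hq hq2
  obtain ⟨B, hB, hB'⟩ := exists_norm_inv_poch_le hq2 hq2
  refine .of_norm_bounded
    ((summable_geometric_of_lt_one (norm_nonneg q) hq).mul_right (A * B)) fun n => ?_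
  rw [lhsTerm, div_eq_mul_inv, mul_inv, norm_mul, norm_mul, norm_pow]
  refine mul_le_mul ?_ (mul_le_mul (hA' _) (hB' _) (norm_nonneg _) hA.le) (by positivity)
    (by positivity)
  exact pow_le_pow_of_le_one (norm_nonneg q) hq.le (by nlinarith [Nat.le_self_pow two_ne_zero n])

/-- The contiguous relation between three consecutive left-hand sides. -/
theorem tsum_lhsTerm_recurrence {q : ℂ} (hq : ‖q‖ < 1) (m : ℕ) :
    q ^ (2 * (m + 1)) * ∑' n, lhsTerm q (m + 2) n =
      ∑' n, lhsTerm q m n - (1 - q ^ (2 * m + 1)) * ∑' n, lhsTerm q (m + 1) n := by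
  have hq2 := norm_sq_lt_one hq
  have h0 := summable_lhsTerm hq m
  have h1 := (summable_lhsTerm hq (m + 1)).mul_left (1 - q ^ (2 * m + 1))
  -- On the right the terms at 0 cancel, and the combined term at n + 1 is q^(2m+2) times the n-th
  -- term of the series for m + 2.
  rw [← tsum_mul_left, ← tsum_mul_left, ← h0.tsum_sub h1, (h0.sub h1).tsum_eq_zero_add]
  have hz : lhsTerm q m 0 - (1 - q ^ (2 * m + 1)) * lhsTerm q (m + 1) 0 = 0 := by
    have e : q ^ (2 * m + 1) = q * (q ^ 2) ^ m := by ring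
    have h2 := poch_ne_zero hq hq2 m
    have h3 := one_sub_mul_pow_ne_zero hq hq2 m
    simp only [lhsTerm, add_zero, poch_zero, poch_succ, e]
    field_simp
    ring
  rw [hz, zero_add]
  congr 1
  ext n
  have e1 : m + (n + 1) = m + n + 1 := by ring
  have e2 : m + 1 + (n + 1) = m + n + 1 + 1 := by ring
  have e3 : m + 2 + n = m + n + 1 + 1 := by ring
  simp only [lhsTerm, e1, e2, e3, poch_succ _ _ n, poch_succ _ _ (m + n + 1)]
  have h1 := poch_ne_zero hq hq2 (m + n + 1)
  have h2 := poch_ne_zero hq2 hq2 n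
  have h3 := one_sub_mul_pow_ne_zero hq hq2 (m + n + 1)
  have h4 := one_sub_mul_pow_ne_zero hq2 hq2 n
  field_simp
  ring

/-! ### Evaluation for m = 0 and m = 1 -/

theorem poch_mul_poch_sq (q : ℂ) (n : ℕ) :
    poch q (q ^ 2) n * poch (q ^ 2) (q ^ 2) n = poch q q (2 * n) := by
  induction n with
  | zero => simp [poch_zero]
  | succ n ih =>
    rw [show 2 * (n + 1) = 2 * n + 1 + 1 by ring, poch_succ, poch_succ, poch_succ, poch_succ, ← ih]
    ring

theorem poch_succ_mul_poch_sq (q : ℂ) (n : ℕ) :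
    poch q (q ^ 2) (1 + n) * poch (q ^ 2) (q ^ 2) n = poch q q (2 * n + 1) := by
  rw [add_comm 1 n, poch_succ, poch_succ, ← poch_mul_poch_sq]
  ring

/-- The denominators for m = 0 and m = 1 are (q;q)_{2n} and (q;q)_{2n+1}, so the two series are the
even and odd parts of Euler's sum. -/
theorem tsum_lhsTerm_zero_add_one {s q : ℂ} (hs : ‖s‖ < 1) (hsq : s ^ 2 = q) :
    pochInf (q ^ 2) (q ^ 2) * (∑' n, lhsTerm q 0 n + s * ∑' n, lhsTerm q 1 n) =
      pochInf₃ (-q ^ 3) (-q ^ 5) (q ^ 8) (q ^ 8) +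
        s * pochInf₃ (-q) (-q ^ 7) (q ^ 8) (q ^ 8) := by
  have hq : ‖q‖ < 1 := hsq ▸ norm_sq_lt_one hs
  have h := hasSum_euler hs
  have e : s * s = q := by rw [← hsq, sq]
  rw [e] at h
  have h1 : HasSum (fun n : ℕ => s ^ n ^ 2 / poch q q n)
      (∑' n, lhsTerm q 0 n + s * ∑' n, lhsTerm q 1 n) := by
    refine HasSum.even_add_odd ?_ ?_
    · convert! (summable_lhsTerm hq 0).hasSum using 1
      ext n
      rw [lhsTerm, zero_add, poch_mul_poch_sq, ← hsq]
      ring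
    · convert! (summable_lhsTerm hq 1).hasSum.mul_left s using 1
      ext n
      rw [lhsTerm, poch_succ_mul_poch_sq, ← hsq]
      ring
  rw [h1.unique h, ← triple_product_dissection hs hsq, pochInf_eq_mul _ hq, pochInf₃]
  have e1 : -s * q = -s ^ 3 := by rw [← hsq]; ring
  have e2 : q ^ 2 = s ^ 4 := by rw [← hsq]; ring
  rw [e1, e2]
  ring

theorem poch_zero_left (q : ℂ) (n : ℕ) : poch 0 q n = 1 := by simp [poch]

theorem pochInf_zero_left (q : ℂ) : pochInf 0 q = 1 := by simp [pochInf]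

theorem tsum_lhsTerm_zero_and_one {q : ℂ} (hq : ‖q‖ < 1) :
    pochInf (q ^ 2) (q ^ 2) * ∑' n, lhsTerm q 0 n =
        pochInf₃ (-q ^ 3) (-q ^ 5) (q ^ 8) (q ^ 8) ∧
      pochInf (q ^ 2) (q ^ 2) * ∑' n, lhsTerm q 1 n =
        pochInf₃ (-q) (-q ^ 7) (q ^ 8) (q ^ 8) := by
  -- Separating the odd part divides by s, so q = 0 is checked by hand.
  rcases eq_or_ne q 0 with rfl | hq0
  · have h : ∀ m, ∑' n, lhsTerm 0 m n = 1 := fun m => by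
      rw [tsum_eq_single 0 fun n hn => by simp [lhsTerm, hn]]
      simp [lhsTerm, poch_zero_left]
    simp [h, pochInf₃, pochInf_zero_left]
  · obtain ⟨s, hs⟩ := IsAlgClosed.exists_pow_nat_eq q two_pos
    have hs1 : ‖s‖ < 1 := by
      rw [← hs, norm_pow] at hq
      exact lt_of_pow_lt_pow_left₀ 2 zero_le_one (by simpa using hq)
    have hs0 : s ≠ 0 := by
      rintro rfl
      exact hq0 (by simpa using hs.symm)
    have h1 := tsum_lhsTerm_zero_add_one hs1 hs
    have h2 := tsum_lhsTerm_zero_add_one (s := -s) (by simpa using hs1) (by simpa using hs)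
    constructor
    · linear_combination (h1 + h2) / 2
    · apply mul_left_cancel₀ hs0
      linear_combination (h1 - h2) / 2

/-! ### The recurrence for a_m and b_m -/

/-- A common form of the terms of `a_m(q)` and `b_m(q)`. -/
noncomputable def trinomialTerm (q : ℂ) (c : ℕ) (M : ℤ) (k l : ℕ) : ℂ :=
  (-1) ^ (k + l) * q ^ (k ^ 2 + c * k + l ^ 2) * gauss (q ^ 2) k l * gauss (q ^ 2) (M - l) k

/-- In range both sides are (q;q)_{M-l} / ((q;q)_l (q;q)_{k-l} (q;q)_{M-k-l}). On the right M enters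
only one factor, so a single q-Pascal step raises M. -/
theorem gauss_mul_gauss {q : ℂ} (hq : ‖q‖ < 1) (M : ℤ) (k l : ℕ) :
    gauss q (M - l) ((k : ℤ) - l) * gauss q (M - k) l = gauss q k l * gauss q (M - l) k := by
  by_cases h : l ≤ k ∧ (k : ℤ) + l ≤ M
  · obtain ⟨h1, h2⟩ := h
    obtain ⟨i, rfl⟩ := Nat.exists_eq_add_of_le h1
    obtain ⟨j, rfl⟩ : ∃ j : ℕ, M = ((l + i : ℕ) : ℤ) + l + j :=
      ⟨(M - ((l + i : ℕ) + l)).toNat, by omega⟩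
    have g1 := gauss_add q i (l + j)
    have g2 := gauss_add q l j
    have g3 := gauss_add q l i
    have g4 := gauss_add q (l + i) j
    push_cast at g1 g2 g3 g4 ⊢
    have e1 : (l : ℤ) + i + l + j - l = i + (l + j) := by ring
    have e2 : (l : ℤ) + i - l = i := by ring
    have e3 : (l : ℤ) + i + l + j - (l + i) = l + j := by ring
    have e4 : (i : ℤ) + (l + j) = l + i + j := by ring
    have e5 : i + (l + j) = l + i + j := by ring
    rw [e1, e2, e3, g1, g2, g3, e4, g4, e5]
    have h1 := poch_ne_zero hq hq (l + j)
    have h2 := poch_ne_zero hq hq (l + i)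
    field_simp
  · by_cases h1 : l ≤ k
    · rw [gauss_of_lt q (show M - k < l by omega), gauss_of_lt q (show M - l < k by omega)]
      simp
    · rw [gauss_of_neg q _ (show (k : ℤ) - l < 0 by omega),
        gauss_of_lt q (show (k : ℤ) < l by omega)]
      simp

theorem neg_one_zpow_sub (k l : ℕ) : (-1 : ℂ) ^ ((k : ℤ) - l) = (-1) ^ (k + l) := by
  rw [zpow_sub₀ (by simp), zpow_natCast, zpow_natCast, pow_add, div_eq_mul_inv, ← inv_pow]
  norm_num

theorem aTerm_eq {q : ℂ} (hq : ‖q‖ < 1) (m k l : ℕ) :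
    aTerm m q k l = trinomialTerm q 0 ((m : ℤ) - 1) k l := by
  rw [aTerm, trinomialTerm, neg_one_zpow_sub, mul_assoc _ (gauss _ _ _),
    gauss_mul_gauss (norm_sq_lt_one hq)]
  ring

theorem bTerm_eq {q : ℂ} (hq : ‖q‖ < 1) (m k l : ℕ) :
    bTerm m q k l = trinomialTerm q 2 ((m : ℤ) - 2) k l := by
  rw [bTerm, trinomialTerm, neg_one_zpow_sub, mul_assoc _ (gauss _ _ _),
    gauss_mul_gauss (norm_sq_lt_one hq)]
  ring

theorem trinomialTerm_eq_zero (q : ℂ) (c : ℕ) {M : ℤ} {k l : ℕ} (h : M < k ∨ M < l) :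
    trinomialTerm q c M k l = 0 := by
  rcases h with h | h
  · rw [trinomialTerm, gauss_of_lt _ (show M - l < k by omega), mul_zero]
  · rw [trinomialTerm, gauss_of_lt _ (show M - l < k by omega), mul_zero]

/-- The sum of the `trinomialTerm`s. -/
noncomputable def trinomialSum (q : ℂ) (c : ℕ) (M : ℤ) : ℂ :=
  ∑ k ∈ Finset.range (M + 1).toNat, ∑ l ∈ Finset.range (M + 1).toNat, trinomialTerm q c M k l

theorem sum_trinomialTerm (q : ℂ) (c : ℕ) {M : ℤ} {K L : ℕ} (hK : M < K) (hL : M < L) :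
    ∑ k ∈ Finset.range K, ∑ l ∈ Finset.range L, trinomialTerm q c M k l =
      trinomialSum q c M := by
  rw [trinomialSum]
  symm
  trans ∑ k ∈ Finset.range (M + 1).toNat, ∑ l ∈ Finset.range L, trinomialTerm q c M k l
  · refine Finset.sum_congr rfl fun k _ => ?_
    refine Finset.sum_subset (Finset.range_mono (by omega)) fun l _ hl => ?_
    rw [Finset.mem_range] at hl
    exact trinomialTerm_eq_zero q c (by omega)
  · refine Finset.sum_subset (Finset.range_mono (by omega)) fun k _ hk => ?_
    rw [Finset.mem_range] at hk
    exact Finset.sum_eq_zero fun l _ => trinomialTerm_eq_zero q c (by omega)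

theorem trinomialTerm_zero_left {q : ℂ} (hq : ‖q‖ < 1) (c : ℕ) {M : ℤ} (hM : 0 ≤ M) (l : ℕ) :
    trinomialTerm q c M 0 l = if l = 0 then 1 else 0 := by
  have hq2 := norm_sq_lt_one hq
  split_ifs with h
  · subst h
    have h1 := gauss_zero_right hq2 hM
    have h2 := gauss_zero_right hq2 le_rfl
    simp [trinomialTerm, h1, h2]
  · rw [trinomialTerm, gauss_of_lt _ (show ((0 : ℕ) : ℤ) < l by omega)]
    ring

theorem gauss_sub_succ_succ {q : ℂ} (hq : ‖q‖ < 1) (M k l : ℕ) :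
    gauss q ((M : ℤ) + 1 - l) ((k + 1 : ℕ) : ℤ) = gauss q ((M : ℤ) - l) ((k + 1 : ℕ) : ℤ) +
      q ^ (M - l - k) * gauss q ((M : ℤ) - l) k := by
  by_cases h : l ≤ M
  · have h1 := gauss_succ hq (show (0 : ℤ) ≤ (M : ℤ) - l by omega) ((k + 1 : ℕ) : ℤ)
    have e1 : (M : ℤ) - l + 1 = M + 1 - l := by ring
    have e2 : ((k + 1 : ℕ) : ℤ) - 1 = k := by push_cast; ring
    have e3 : ((M : ℤ) + 1 - l - ((k + 1 : ℕ) : ℤ)).toNat = M - l - k := by omega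
    rwa [e1, e2, e3] at h1
  · rw [gauss_of_lt q (show (M : ℤ) + 1 - l < (k + 1 : ℕ) by omega),
      gauss_of_lt q (show (M : ℤ) - l < (k + 1 : ℕ) by omega),
      gauss_of_lt q (show (M : ℤ) - l < k by omega)]
    ring

theorem trinomialTerm_succ_zero {q : ℂ} (hq : ‖q‖ < 1) (c M k : ℕ) :
    trinomialTerm q c ((M : ℤ) + 1) (k + 1) 0 - trinomialTerm q c M (k + 1) 0 =
      -(q ^ (2 * M + 1 + c) * trinomialTerm q c M k 0) := by
  have hq2 := norm_sq_lt_one hq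
  have g1 := gauss_zero_right hq2 (show (0 : ℤ) ≤ (k + 1 : ℕ) by omega)
  have g2 := gauss_zero_right hq2 (show (0 : ℤ) ≤ k by omega)
  have g3 := gauss_sub_succ_succ hq2 M k 0
  simp only [Nat.cast_zero, Nat.sub_zero] at g3
  simp only [trinomialTerm, g3, Nat.cast_zero, g1, g2]
  by_cases h : k ≤ M
  · obtain ⟨i, rfl⟩ := Nat.exists_eq_add_of_le h
    have e : k + i - k = i := by omega
    rw [e]
    ring
  · rw [gauss_of_lt _ (show (M : ℤ) - 0 < k by omega)]
    ring

/-- One q-Pascal rule in M leaves the difference as a single product; the other, applied to its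
factor with entries k + 1 and l + 1, splits it into the two terms on the right. -/
theorem trinomialTerm_succ_succ {q : ℂ} (hq : ‖q‖ < 1) (c M k l : ℕ) :
    trinomialTerm q c ((M : ℤ) + 1) (k + 1) (l + 1) - trinomialTerm q c M (k + 1) (l + 1) =
      -(q ^ (2 * M + 1 + c) * trinomialTerm q c M k (l + 1)) +
        q ^ (2 * M + c) * trinomialTerm q c ((M : ℤ) - 1) k l := by
  have hq2 := norm_sq_lt_one hq
  have g1 := gauss_succ' hq2 (show (0 : ℤ) ≤ k by omega) ((l + 1 : ℕ) : ℤ)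
  have g3 := gauss_sub_succ_succ hq2 M k (l + 1)
  have e1 : ((l + 1 : ℕ) : ℤ) - 1 = l := by push_cast; ring
  have e2 : (k : ℤ) + 1 = (k + 1 : ℕ) := by push_cast; ring
  have e3 : (M : ℤ) - 1 - l = M - (l + 1 : ℕ) := by push_cast; ring
  rw [e1, e2, Int.toNat_natCast] at g1
  simp only [trinomialTerm, g3, g1, e3]
  by_cases h : k + (l + 1) ≤ M
  · obtain ⟨i, rfl⟩ := Nat.exists_eq_add_of_le h
    have e : k + (l + 1) + i - (l + 1) - k = i := by omega
    rw [e]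
    ring
  · rw [gauss_of_lt _ (show (M : ℤ) - (l + 1 : ℕ) < k by omega)]
    ring

theorem trinomialSum_succ {q : ℂ} (hq : ‖q‖ < 1) (c M : ℕ) :
    trinomialSum q c ((M : ℤ) + 1) = (1 - q ^ (2 * M + 1 + c)) * trinomialSum q c M +
      q ^ (2 * M + c) * trinomialSum q c ((M : ℤ) - 1) := by
  -- The ranges are padded with zero terms so that they agree after removing k = 0 and l = 0.
  have h1 := sum_trinomialTerm q c (M := (M : ℤ) + 1) (K := M + 3) (L := M + 3)
    (by omega) (by omega)
  have h2 := sum_trinomialTerm q c (M := M) (K := M + 3) (L := M + 3) (by omega) (by omega)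
  have h3 := sum_trinomialTerm q c (M := M) (K := M + 2) (L := M + 3) (by omega) (by omega)
  have h4 := sum_trinomialTerm q c (M := (M : ℤ) - 1) (K := M + 2) (L := M + 2)
    (by omega) (by omega)
  suffices h : trinomialSum q c ((M : ℤ) + 1) - trinomialSum q c M =
      -(q ^ (2 * M + 1 + c) * trinomialSum q c M) +
        q ^ (2 * M + c) * trinomialSum q c ((M : ℤ) - 1) by
    linear_combination h
  rw [← h1, ← h4]
  nth_rw 1 [← h2]
  rw [← h3, Finset.sum_range_succ',
    Finset.sum_range_succ' (fun k => ∑ l ∈ Finset.range (M + 3), trinomialTerm q c M k l),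
    add_sub_add_comm]
  simp only [trinomialTerm_zero_left hq c (show (0 : ℤ) ≤ M by omega),
    trinomialTerm_zero_left hq c (show (0 : ℤ) ≤ (M : ℤ) + 1 by omega), sub_self, add_zero]
  rw [← Finset.sum_sub_distrib, Finset.mul_sum, Finset.mul_sum, ← Finset.sum_neg_distrib,
    ← Finset.sum_add_distrib]
  refine Finset.sum_congr rfl fun k _ => ?_
  rw [← Finset.sum_sub_distrib, Finset.sum_range_succ', trinomialTerm_succ_zero hq,
    Finset.sum_range_succ' (fun l => trinomialTerm q c M k l)]
  simp_rw [trinomialTerm_succ_succ hq]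
  rw [Finset.sum_add_distrib, Finset.sum_neg_distrib, ← Finset.mul_sum, ← Finset.mul_sum]
  ring

theorem a_eq {q : ℂ} (hq : ‖q‖ < 1) (m : ℕ) : a m q = trinomialSum q 0 ((m : ℤ) - 1) := by
  rw [← sum_trinomialTerm q 0 (M := (m : ℤ) - 1) (K := m) (L := m) (by omega) (by omega), a]
  simp_rw [aTerm_eq hq]
  split_ifs with h
  · simp [h]
  · rfl

theorem b_eq {q : ℂ} (hq : ‖q‖ < 1) {m : ℕ} (hm : m ≠ 0) :
    b m q = trinomialSum q 2 ((m : ℤ) - 2) := by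
  rw [← sum_trinomialTerm q 2 (M := (m : ℤ) - 2) (K := m) (L := m) (by omega) (by omega), b,
    if_neg hm]
  simp_rw [bTerm_eq hq]

theorem trinomialSum_of_neg (q : ℂ) (c : ℕ) {M : ℤ} (hM : M < 0) : trinomialSum q c M = 0 := by
  rw [trinomialSum, show (M + 1).toNat = 0 by omega, Finset.sum_range_zero]

theorem trinomialSum_zero {q : ℂ} (hq : ‖q‖ < 1) (c : ℕ) : trinomialSum q c 0 = 1 := by
  have h := trinomialTerm_zero_left hq c le_rfl 0
  simpa [trinomialSum] using h

theorem a_recurrence {q : ℂ} (hq : ‖q‖ < 1) (m : ℕ) :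
    a (m + 2) q = (1 - q ^ (2 * m + 1)) * a (m + 1) q + q ^ (2 * m) * a m q := by
  have h := trinomialSum_succ hq 0 m
  rw [a_eq hq, a_eq hq, a_eq hq]
  have e1 : ((m + 2 : ℕ) : ℤ) - 1 = m + 1 := by push_cast; ring
  have e2 : ((m + 1 : ℕ) : ℤ) - 1 = m := by push_cast; ring
  rw [e1, e2, h, add_zero, add_zero]

theorem b_recurrence {q : ℂ} (hq : ‖q‖ < 1) (m : ℕ) :
    b (m + 2) q = (1 - q ^ (2 * m + 1)) * b (m + 1) q + q ^ (2 * m) * b m q := by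
  rw [b_eq hq (m := m + 2) (by omega), b_eq hq (m := m + 1) (by omega)]
  -- The convention b_0 = 1 is not a value of `trinomialSum`, so the first instance of the
  -- recurrence is checked directly.
  rcases m with _ | m
  · rw [trinomialSum_of_neg q 2 (M := ((0 + 1 : ℕ) : ℤ) - 2) (by norm_num)]
    simp [trinomialSum_zero hq, b]
  · have h := trinomialSum_succ hq 2 m
    rw [b_eq hq (m := m + 1) (by omega)]
    have e1 : ((m + 1 + 2 : ℕ) : ℤ) - 2 = m + 1 := by push_cast; ring
    have e2 : ((m + 1 + 1 : ℕ) : ℤ) - 2 = m := by push_cast; ring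
    have e3 : ((m + 1 : ℕ) : ℤ) - 2 = m - 1 := by push_cast; ring
    rw [e1, e2, e3, h]
    ring

/-! ### Induction on m and conclusion -/

theorem pochInf_mul_tsum_lhsTerm {q : ℂ} (hq : ‖q‖ < 1) (m : ℕ) :
    pochInf (q ^ 2) (q ^ 2) * q ^ (m * (m - 1)) * ∑' n, lhsTerm q m n =
      (-1) ^ (m + 1) * (a m q * pochInf₃ (-q) (-q ^ 7) (q ^ 8) (q ^ 8) -
        b m q * pochInf₃ (-q ^ 3) (-q ^ 5) (q ^ 8) (q ^ 8)) := by
  obtain ⟨h0, h1⟩ := tsum_lhsTerm_zero_and_one hq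
  induction m using Nat.twoStepInduction with
  | zero =>
    rw [← h0]
    simp [a, b]
  | one =>
    rw [← h1, a_eq hq, b_eq hq one_ne_zero, trinomialSum_of_neg q 2 (by norm_num)]
    simp [trinomialSum_zero hq]
  | more m ih0 ih1 =>
    have hF := tsum_lhsTerm_recurrence hq m
    rw [a_recurrence hq, b_recurrence hq]
    have e1 : q ^ ((m + 2) * (m + 2 - 1)) = q ^ ((m + 1) * (m + 1 - 1)) * q ^ (2 * (m + 1)) := by
      rw [← pow_add]; congr 1; simp only [Nat.add_sub_cancel, Nat.add_succ_sub_one]; ring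
    have e2 : q ^ ((m + 1) * (m + 1 - 1)) = q ^ (m * (m - 1)) * q ^ (2 * m) := by
      rw [← pow_add]
      congr 1
      rcases m with _ | m
      · rfl
      · simp only [Nat.add_sub_cancel]; ring
    rw [e1, mul_assoc, mul_assoc (q ^ _), hF]
    linear_combination q ^ (2 * m) * ih0 - (1 - q ^ (2 * m + 1)) * ih1 +
      pochInf (q ^ 2) (q ^ 2) * (∑' n, lhsTerm q m n) * e2

end QSeries

theorem corollary3p4 (m : ℕ) (q : ℂ) (hq : ‖q‖ < 1) (hq0 : 2 ≤ m → q ≠ 0) :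
    HasSum
      (fun n : ℕ => q ^ (2 * n ^ 2 + 2 * m * n) /
        (QSeries.poch q (q ^ 2) (m + n) * QSeries.poch (q ^ 2) (q ^ 2) n))
      ((-1 : ℂ) ^ ((m : ℤ) - 1) /
          (q ^ ((m : ℤ) * ((m : ℤ) - 1)) * QSeries.pochInf (q ^ 2) (q ^ 2)) *
        (QSeries.a m q * QSeries.pochInf₃ (-q) (-q ^ 7) (q ^ 8) (q ^ 8) -
          QSeries.b m q * QSeries.pochInf₃ (-q ^ 3) (-q ^ 5) (q ^ 8) (q ^ 8))) := by
  have hq2 := QSeries.norm_sq_lt_one hq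
  have hP := QSeries.pochInf_ne_zero hq2 hq2
  have hsign : (-1 : ℂ) ^ ((m : ℤ) - 1) = (-1) ^ (m + 1) := by
    simpa using QSeries.neg_one_zpow_sub m 1
  have hpow : q ^ ((m : ℤ) * ((m : ℤ) - 1)) = q ^ (m * (m - 1)) := by
    rw [← zpow_natCast]
    congr 1
    rcases m with _ | m
    · rfl
    · push_cast [Nat.add_sub_cancel]; ring
  -- For m < 2 the exponent is 0, so q = 0 is harmless there.
  have hq' : q ^ (m * (m - 1)) ≠ 0 := by
    rcases lt_or_ge m 2 with h | h
    · interval_cases m <;> simp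
    · exact pow_ne_zero _ (hq0 h)
  convert! (QSeries.summable_lhsTerm hq m).hasSum using 1
  rw [hsign, hpow, div_mul_eq_mul_div, ← QSeries.pochInf_mul_tsum_lhsTerm hq]
  field_simp
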